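/- Fix countably infinite sets $\mathrm{PVAR}$ (program variables) and $\mathrm{LOC}$ (locations). Formulae are given by $$\varphi ::= x=y \mid x\hookrightarrow y \mid \mathsf{emp} \mid \mathsf{alloc}(x) \mid \neg\varphi \mid \varphi\wedge\varphi \mid \varphi*\varphi \qquad (x,y\in\mathrm{PVAR}),$$ with $\Rightarrow,\vee,\Leftrightarrow$ the usual abbreviations, $x\neq y := \neg(x=y)$, $\bot := x\neq x$ (for a fixed variable), $\top:=\neg\bot$, $\mathsf{size}\ge 0:=\top$, $\mathsf{size}\ge 1:=\neg\mathsf{emp}$, $\mathsf{size}\ge\beta+2 := \neg\mathsf{emp} * \mathsf{size}\ge\beta+1$ and $\mathsf{size}=\beta := \mathsf{size}\ge\beta\wedge\neg\,\mathsf{size}\ge\beta+1$. They are interpreted on pairs $(s,h)$ of a store $s:\mathrm{PVAR}\to\mathrm{LOC}$ and a heap $h$ (a partial function $\mathrm{LOC}\to\mathrm{LOC}$ with finite domain): $(s,h)\models x=y$ iff $s(x)=s(y)$; $(s,h)\models\mathsf{emp}$ iff $\mathrm{dom}(h)=\emptyset$; $(s,h)\models x\hookrightarrow y$ iff $s(x)\in\mathrm{dom}(h)$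 and $h(s(x))=s(y)$; $(s,h)\models\mathsf{alloc}(x)$ iff $s(x)\in\mathrm{dom}(h)$; $\neg,\wedge$ are Boolean; $(s,h)\models\varphi*\psi$ iff $h$ is the union of two heaps $h_1,h_2$ with disjoint domains such that $(s,h_1)\models\varphi$ and $(s,h_2)\models\psi$. The Hilbert-style system $\mathcal H_C(*)$ consists of axiom schemata for classical propositional calculus, modus ponens, the rule "from $\varphi\Rightarrow\chi$ infer $\varphi*\psi\Rightarrow\chi*\psi$", and the axiom schemata (for all formulae $\varphi,\psi,\chi$, variables $x,y,z$ and $\beta_1,\beta_2\in\mathbb N$, with $a\mathbin{\dot-}b=\max(0,a-b)$): - $x=x$; $\ \varphi\wedge x=y\Rightarrow\varphi'$, where $\varphi'$ is $\varphi$ with every occurrence of $y$ replaced by $x$; $\ x\hookrightarrow y\Rightarrow\mathsf{alloc}(x)$; $\ x\hookrightarrow y\wedge x\hookrightarrow z\Rightarrow y=z$; - $\varphi*\psi\Leftrightarrow\psi*\varphi$; $\ (\varphi*\psi)*\chi\Leftrightarrow\varphi*(\psi*\chi)$; $\ (\varphi\vee\psi)*\chi\Rightarrow(\varphi*\chi)\vee(\psi*\chi)$;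 $\ \bot*\varphi\Leftrightarrow\bot$; $\ \varphi\Leftrightarrow\varphi*\mathsf{emp}$; - $\mathsf{alloc}(x)*\top\Rightarrow\mathsf{alloc}(x)$; $\ \mathsf{alloc}(x)*\mathsf{alloc}(x)\Leftrightarrow\bot$; $\ e*\top\Rightarrow e$ for $e\in\{\neg\mathsf{emp},\,x=y,\,x\ne y,\,x\hookrightarrow y\}$; $\ \neg\mathsf{alloc}(x)*\neg\mathsf{alloc}(x)\Rightarrow\neg\mathsf{alloc}(x)$; $\ (\mathsf{alloc}(x)\wedge\neg x\hookrightarrow y)*\top\Rightarrow\neg x\hookrightarrow y$; - $\mathsf{alloc}(x)\Rightarrow(\mathsf{alloc}(x)\wedge\mathsf{size}=1)*\top$; $\ \neg\mathsf{emp}\Rightarrow\mathsf{size}=1*\top$; $\ \neg\,\mathsf{size}\ge\beta_1*\neg\,\mathsf{size}\ge\beta_2\Rightarrow\neg\,\mathsf{size}\ge\beta_1+\beta_2\mathbin{\dot-}1$; $\ \mathsf{alloc}(x)\wedge\mathsf{alloc}(y)\wedge x\ne y\Rightarrow\mathsf{size}\ge2$. For a finite $X\subseteq\mathrm{PVAR}$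 and $\alpha\in\mathbb N$, let $\mathrm{Core}(X,\alpha)$ be the set of core formulae $x=y$, $\mathsf{alloc}(x)$, $x\hookrightarrow y$, $\mathsf{size}\ge\beta$ with $x,y\in X$ and $0\le\beta\le\alpha$. A literal is a core formula or its negation; $\mathrm{Conj}(\mathrm{Core}(X,\alpha))$ is the set of finite conjunctions of literals built on $\mathrm{Core}(X,\alpha)$, and $\mathrm{CoreTypes}(X,\alpha)$ is the set of those conjunctions in which, for every $c\in\mathrm{Core}(X,\alpha)$, exactly one of $c$, $\neg c$ occurs. Write $\ell\in\varphi$ when $\ell$ is one of the literals of the conjunction $\varphi$. For core types $\varphi,\psi$ let $\langle\varphi*\psi\rangle$ be the conjunction of the following literals: - $x=y$ whenever $x=y\in\varphi$ or $x=y\in\psi$, and $x\ne y$ whenever $x\neq y\in\varphi$ or $x\ne y\in\psi$; - $\mathsf{alloc}(x)$ whenever $\mathsf{alloc}(x)\in\varphi$ or $\mathsf{alloc}(x)\in\psi$; $\neg\mathsf{alloc}(x)$ whenever $\neg\mathsf{alloc}(x)\in\varphi$ and $\neg\mathsf{alloc}(x)\in\psi$; - $x\hookrightarrow y$ whenever $x\hookrightarrow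 y\in\varphi$ or $x\hookrightarrow y\in\psi$; $\neg x\hookrightarrow y$ whenever $\mathsf{alloc}(x)$ and $\neg x\hookrightarrow y$ are both in $\varphi$ or both in $\psi$; - $x\ne x$ whenever $\mathsf{alloc}(x)\in\varphi$ and $\mathsf{alloc}(x)\in\psi$; - $\mathsf{size}\ge\beta_1+\beta_2$ whenever $\mathsf{size}\ge\beta_1\in\varphi$ and $\mathsf{size}\ge\beta_2\in\psi$; $\neg\,\mathsf{size}\ge\beta_1+\beta_2\mathbin{\dot-}1$ whenever $\neg\,\mathsf{size}\ge\beta_1\in\varphi$ and $\neg\,\mathsf{size}\ge\beta_2\in\psi$. **Theorem (star elimination).** Let $X\subseteq\mathrm{PVAR}$ be finite, $\alpha\ge|X|$, and $\varphi,\psi\in\mathrm{CoreTypes}(X,\alpha)$. Then: 1. there is $\chi\in\mathrm{Conj}(\mathrm{Core}(X,2\alpha))$ such that $\vdash_{\mathcal H_C(*)}\varphi*\psi\Leftrightarrow\chi$; 2. if $\varphi$ and $\psi$ are both satisfiable, then $\langle\varphi*\psi\rangle$ is a (finite) conjunction in $\mathrm{Conj}(\mathrm{Core}(X,2\alpha))$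 and $\vdash_{\mathcal H_C(*)}\varphi*\psi\Leftrightarrow\langle\varphi*\psi\rangle$, whichever enumeration of its literals is used. -/

import Mathlib

namespace SepLog

/-- Program variables: a countably infinite set. -/
abbrev PVar : Type := ℕ

/-- Locations: a countably infinite set. -/
abbrev Loc : Type := ℕ

/-- Formulae of the separation logic with separating conjunction, in which `alloc x` is atomic
and there is no separating implication. -/
inductive Formula : Type
  | eq (x y : PVar) : Formula
  | pointsTo (x y : PVar) : Formula
  | emp : Formula
  | alloc (x : PVar) : Formula
  | neg (φ : Formula) : Formula
  | and (φ ψ : Formula) : Formula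
  | star (φ ψ : Formula) : Formula

namespace Formula

/-- `φ ⇒ ψ`, as an abbreviation. -/
def imp (φ ψ : Formula) : Formula := neg (and φ (neg ψ))

/-- `φ ∨ ψ`, as an abbreviation. -/
def or (φ ψ : Formula) : Formula := neg (and (neg φ) (neg ψ))

/-- `φ ⇔ ψ`, as an abbreviation. -/
def iff (φ ψ : Formula) : Formula := and (imp φ ψ) (imp ψ φ)

/-- `x ≠ y`. -/
def ne (x y : PVar) : Formula := neg (eq x y)

/-- The contradiction `x ≠ x`, for one fixed variable `x`. -/
def bot : Formula := ne 0 0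

/-- The negation of the contradiction. -/
def top : Formula := neg bot

/-- `size ≥ β`: true for `β = 0`, `¬ emp` for `β = 1`, and `¬ emp * size ≥ β - 1` otherwise. -/
def sizeGe : ℕ → Formula
  | 0 => top
  | 1 => neg emp
  | β + 2 => star (neg emp) (sizeGe (β + 1))

/-- `size = β`, that is `size ≥ β ∧ ¬ size ≥ β + 1`. -/
def sizeEq (β : ℕ) : Formula := and (sizeGe β) (neg (sizeGe (β + 1)))

/-- `φ.subst x y` is `φ` with every occurrence of `y` replaced with `x`. -/
def subst (x y : PVar) : Formula → Formula
  | eq a b => eq (if a = y then x else a) (if b = y then x else b)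
  | pointsTo a b => pointsTo (if a = y then x else a) (if b = y then x else b)
  | emp => emp
  | alloc a => alloc (if a = y then x else a)
  | neg φ => neg (subst x y φ)
  | and φ ψ => and (subst x y φ) (subst x y ψ)
  | star φ ψ => star (subst x y φ) (subst x y ψ)

end Formula

/-! ### Semantics -/

/-- Stores. -/
abbrev Store : Type := PVar → Loc

/-- Heaps: partial functions from locations to locations with finite domain. -/
abbrev Heap : Type := Finmap (fun _ : Loc => Loc)

/-- The satisfaction relation on memory states. For disjoint heaps, `∪` is the disjoint union
of their graphs. -/
def Satisfies (s : Store) : Heap → Formula → Prop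
  | _, .eq x y => s x = s y
  | h, .pointsTo x y => h.lookup (s x) = some (s y)
  | h, .emp => h.keys = ∅
  | h, .alloc x => s x ∈ h.keys
  | h, .neg φ => ¬ Satisfies s h φ
  | h, .and φ ψ => Satisfies s h φ ∧ Satisfies s h ψ
  | h, .star φ ψ => ∃ h₁ h₂ : Heap, h₁.Disjoint h₂ ∧ h₁ ∪ h₂ = h ∧
      Satisfies s h₁ φ ∧ Satisfies s h₂ ψ

/-- Satisfiability: some memory state satisfies the formula. -/
def Satisfiable (φ : Formula) : Prop := ∃ (s : Store) (h : Heap), Satisfies s h φ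

/-! ### The proof system -/

open Formula in
/-- Derivability in the Hilbert-style proof system for the logic with separating conjunction. -/
inductive Provable : Formula → Prop
  -- propositional calculus
  | imp_const (φ ψ : Formula) : Provable (imp φ (imp ψ φ))
  | imp_distr (φ ψ χ : Formula) :
      Provable (imp (imp φ (imp ψ χ)) (imp (imp φ ψ) (imp φ χ)))
  | contra (φ ψ : Formula) : Provable (imp (imp (neg φ) (neg ψ)) (imp ψ φ))
  | and_left (φ ψ : Formula) : Provable (imp (and φ ψ) φ)
  | and_right (φ ψ : Formula) : Provable (imp (and φ ψ) ψ)
  | and_intro (φ ψ : Formula) : Provable (imp φ (imp ψ (and φ ψ)))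
  | modus_ponens (φ ψ : Formula) : Provable (imp φ ψ) → Provable φ → Provable ψ
  -- core formulae
  | eq_refl (x : PVar) : Provable (eq x x)
  | eq_subst (φ : Formula) (x y : PVar) : Provable (imp (and φ (eq x y)) (φ.subst x y))
  | pointsTo_alloc (x y : PVar) : Provable (imp (pointsTo x y) (alloc x))
  | pointsTo_inj (x y z : PVar) :
      Provable (imp (and (pointsTo x y) (pointsTo x z)) (eq y z))
  -- separating conjunction
  | star_comm (φ ψ : Formula) : Provable (iff (star φ ψ) (star ψ φ))
  | star_assoc (φ ψ χ : Formula) :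
      Provable (iff (star (star φ ψ) χ) (star φ (star ψ χ)))
  | star_or (φ ψ χ : Formula) :
      Provable (imp (star (or φ ψ) χ) (or (star φ χ) (star ψ χ)))
  | star_bot (φ : Formula) : Provable (iff (star bot φ) bot)
  | star_emp (φ : Formula) : Provable (iff φ (star φ emp))
  | star_alloc (x : PVar) : Provable (imp (star (alloc x) top) (alloc x))
  | double_alloc (x : PVar) : Provable (iff (star (alloc x) (alloc x)) bot)
  | mono_not_emp : Provable (imp (star (neg emp) top) (neg emp))
  | mono_eq (x y : PVar) : Provable (imp (star (eq x y) top) (eq x y))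
  | mono_ne (x y : PVar) : Provable (imp (star (ne x y) top) (ne x y))
  | mono_pointsTo (x y : PVar) : Provable (imp (star (pointsTo x y) top) (pointsTo x y))
  | alloc_neg (x : PVar) :
      Provable (imp (star (neg (alloc x)) (neg (alloc x))) (neg (alloc x)))
  | pointsTo_neg (x y : PVar) :
      Provable (imp (star (and (alloc x) (neg (pointsTo x y))) top) (neg (pointsTo x y)))
  | alloc_size_one (x : PVar) :
      Provable (imp (alloc x) (star (and (alloc x) (sizeEq 1)) top))
  | size_one : Provable (imp (neg emp) (star (sizeEq 1) top))
  -- natural-number subtraction is truncated, as intended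
  | size_neg (β₁ β₂ : ℕ) :
      Provable (imp (star (neg (sizeGe β₁)) (neg (sizeGe β₂))) (neg (sizeGe (β₁ + β₂ - 1))))
  | size_two (x y : PVar) :
      Provable (imp (and (and (alloc x) (alloc y)) (ne x y)) (sizeGe 2))
  | star_intro (φ ψ χ : Formula) :
      Provable (imp φ χ) → Provable (imp (star φ ψ) (star χ ψ))

/-! ### Core formulae, literals, core types -/

/-- Core formulae. -/
inductive CoreFormula : Type
  | eq (x y : PVar) : CoreFormula
  | alloc (x : PVar) : CoreFormula
  | pointsTo (x y : PVar) : CoreFormula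
  | sizeGe (β : ℕ) : CoreFormula

/-- The formula denoted by a core formula. -/
def CoreFormula.toFormula : CoreFormula → Formula
  | .eq x y => .eq x y
  | .alloc x => .alloc x
  | .pointsTo x y => .pointsTo x y
  | .sizeGe β => .sizeGe β

/-- The core formulae over the variables `X` with size bound `α`. -/
def coreFormulae (X : Finset PVar) (α : ℕ) : Set CoreFormula :=
  {c | match c with
    | .eq x y => x ∈ X ∧ y ∈ X
    | .alloc x => x ∈ X
    | .pointsTo x y => x ∈ X ∧ y ∈ X
    | .sizeGe β => β ≤ α}

/-- Literals: core formulae and their negations. -/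
inductive Literal : Type
  | pos (c : CoreFormula) : Literal
  | neg (c : CoreFormula) : Literal

/-- The core formula that a literal is built upon. -/
def Literal.core : Literal → CoreFormula
  | .pos c => c
  | .neg c => c

/-- The formula denoted by a literal. -/
def Literal.toFormula : Literal → Formula
  | .pos c => c.toFormula
  | .neg c => .neg c.toFormula

/-- The conjunction of a list of literals; the empty conjunction is true. -/
def conj : List Literal → Formula
  | [] => .top
  | [l] => l.toFormula
  | l :: l' :: L => .and l.toFormula (conj (l' :: L))

/-- The set of literals of a conjunction. -/
def literals (φ : List Literal) : Set Literal := {l | l ∈ φ}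

/-- Conjunctions of literals built upon the core formulae over `X` with size bound `α`. -/
def conjComb (X : Finset PVar) (α : ℕ) : Set (List Literal) :=
  {φ | ∀ l ∈ literals φ, l.core ∈ coreFormulae X α}

/-- Core types: conjunctions of literals in which every core formula over `X` with size bound
`α` occurs either positively or negatively, and not both. -/
def coreTypes (X : Finset PVar) (α : ℕ) : Set (List Literal) :=
  {φ | φ ∈ conjComb X α ∧ ∀ c ∈ coreFormulae X α,
    (.pos c ∈ literals φ ∨ .neg c ∈ literals φ) ∧
    ¬ (.pos c ∈ literals φ ∧ .neg c ∈ literals φ)}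

open CoreFormula Literal in
/-- The literals of the formula that describes the separating conjunction of two core types. -/
def boxStar (φ ψ : List Literal) : Set Literal :=
  {l | ∃ x y, (l = pos (eq x y) ∨ l = neg (eq x y)) ∧ (l ∈ literals φ ∨ l ∈ literals ψ)} ∪
  {l | ∃ x, l = pos (alloc x) ∧ (l ∈ literals φ ∨ l ∈ literals ψ)} ∪
  {l | ∃ x, l = neg (alloc x) ∧ (l ∈ literals φ ∧ l ∈ literals ψ)} ∪
  {l | ∃ x y, l = neg (pointsTo x y) ∧
    ((pos (alloc x) ∈ literals φ ∧ neg (pointsTo x y) ∈ literals φ) ∨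
     (pos (alloc x) ∈ literals ψ ∧ neg (pointsTo x y) ∈ literals ψ))} ∪
  {l | ∃ x, l = neg (eq x x) ∧
    (pos (alloc x) ∈ literals φ ∧ pos (alloc x) ∈ literals ψ)} ∪
  {l | ∃ β₁ β₂, l = pos (sizeGe (β₁ + β₂)) ∧
    pos (sizeGe β₁) ∈ literals φ ∧ pos (sizeGe β₂) ∈ literals ψ} ∪
  {l | ∃ x y, l = pos (pointsTo x y) ∧ (l ∈ literals φ ∨ l ∈ literals ψ)} ∪
  {l | ∃ β₁ β₂, l = neg (sizeGe (β₁ + β₂ - 1)) ∧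
    neg (sizeGe β₁) ∈ literals φ ∧ neg (sizeGe β₂) ∈ literals ψ}

end SepLog

namespace SepLog

open Formula

/-! ### Theories and worlds -/

/-- Sets of formulae that contain all theorems and are closed under modus ponens. -/
structure IsTheory (T : Set Formula) : Prop where
  thm : ∀ {φ}, Provable φ → φ ∈ T
  mp : ∀ {φ ψ}, imp φ ψ ∈ T → φ ∈ T → ψ ∈ T

namespace IsTheory

variable {T : Set Formula} {φ ψ χ : Formula}

/-- This is the deduction theorem. It needs only the first two propositional axioms because theories
are closed under modus ponens alone; the star rule is applied to theorems only. -/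
theorem adjoin (hT : IsTheory T) (χ : Formula) : IsTheory {φ | imp χ φ ∈ T} where
  thm h := hT.mp (hT.thm (.imp_const _ _)) (hT.thm h)
  mp h₁ h₂ := hT.mp (hT.mp (hT.thm (.imp_distr _ _ _)) h₁) h₂

theorem weaken (hT : IsTheory T) (χ : Formula) (h : φ ∈ T) : imp χ φ ∈ T :=
  hT.mp (hT.thm (.imp_const _ _)) h

theorem imp_self (hT : IsTheory T) (χ : Formula) : imp χ χ ∈ T :=
  hT.mp (hT.mp (hT.thm (.imp_distr χ (imp χ χ) χ)) (hT.thm (.imp_const _ _)))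
    (hT.thm (.imp_const _ _))

theorem exfalso (hT : IsTheory T) (h : φ ∈ T) (h' : neg φ ∈ T) : ψ ∈ T :=
  hT.mp (hT.mp (hT.thm (.contra ψ φ)) (hT.weaken _ h')) h

theorem of_neg_imp_absurd (hT : IsTheory T) (h : imp (neg φ) ψ ∈ T)
    (h' : imp (neg φ) (neg ψ) ∈ T) : φ ∈ T := by
  -- Any theorem would do in place of `eq 0 0`: its negation serves as falsum, and contraposition
  -- removes it.
  have key : imp (neg φ) (neg (eq 0 0)) ∈ T := (hT.adjoin (neg φ)).exfalso (φ := ψ) h h'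
  exact hT.mp (hT.mp (hT.thm (.contra φ (eq 0 0))) key) (hT.thm (.eq_refl 0))

theorem by_cases (hT : IsTheory T) (h : imp ψ φ ∈ T) (h' : imp (neg ψ) φ ∈ T) : φ ∈ T := by
  have hN := hT.adjoin (neg φ)
  have hψ : ψ ∈ {χ | imp (neg φ) χ ∈ T} :=
    hN.of_neg_imp_absurd (ψ := φ) (hT.weaken _ h') (hN.weaken _ (hT.imp_self _))
  exact hT.of_neg_imp_absurd (ψ := φ) (hN.mp (hT.weaken _ h) hψ) (hT.imp_self _)

end IsTheory

/-- Maximal consistent sets of formulae, the worlds of the canonical model. -/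
structure World where
  carrier : Set Formula
  isTheory : IsTheory carrier
  neg_mem_iff' : ∀ φ, neg φ ∈ carrier ↔ φ ∉ carrier

instance : Membership Formula World := ⟨fun w φ => φ ∈ w.carrier⟩

/-- Lindenbaum's lemma. A theory maximal among those omitting `φ` must decide every `ψ`: if it
contained neither `ψ` nor its negation, adjoining either would yield `φ`, and then `φ` follows by
cases. -/
theorem IsTheory.exists_world {T : Set Formula} (hT : IsTheory T) {φ : Formula} (hφ : φ ∉ T) :
    ∃ w : World, T ⊆ w.carrier ∧ φ ∉ w := by
  obtain ⟨M, hTM, hM⟩ := zorn_subset_nonempty {S | IsTheory S ∧ φ ∉ S} (by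
    intro c hc hchain ⟨S₀, hS₀⟩
    refine ⟨⋃₀ c, ⟨⟨fun h => ⟨S₀, hS₀, (hc hS₀).1.thm h⟩, ?_⟩, ?_⟩,
      fun S hS => Set.subset_sUnion_of_mem hS⟩
    · rintro a b ⟨S, hS, h⟩ ⟨S', hS', h'⟩
      rcases hchain.total hS hS' with hle | hle
      · exact ⟨S', hS', (hc hS').1.mp (hle h) h'⟩
      · exact ⟨S, hS, (hc hS).1.mp h (hle h')⟩
    · rintro ⟨S, hS, h⟩
      exact (hc hS).2 h) T ⟨hT, hφ⟩
  obtain ⟨hMT, hMφ⟩ := hM.prop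
  have grow : ∀ ψ, ψ ∉ M → imp ψ φ ∈ M := by
    intro ψ hψ
    by_contra hn
    exact hψ (hM.le_of_ge ⟨hMT.adjoin ψ, hn⟩ (fun a ha => hMT.weaken _ ha) (hMT.imp_self ψ))
  refine ⟨⟨M, hMT, fun ψ => ⟨fun h h' => hMφ (hMT.exfalso h' h), fun h => ?_⟩⟩, hTM, hMφ⟩
  by_contra hn
  exact hMφ (hMT.by_cases (grow _ h) (grow _ hn))

theorem isTheory_provable : IsTheory {φ | Provable φ} :=
  ⟨fun h => h, fun h h' => .modus_ponens _ _ h h'⟩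

theorem provable_iff_forall_mem {φ : Formula} : Provable φ ↔ ∀ w : World, φ ∈ w := by
  refine ⟨fun h w => w.isTheory.thm h, fun h => ?_⟩
  by_contra hn
  obtain ⟨w, -, hw⟩ := isTheory_provable.exists_world hn
  exact hw (h w)

namespace World

variable {w u v : World} {φ ψ χ : Formula}

theorem thm (w : World) (h : Provable φ) : φ ∈ w := w.isTheory.thm h

theorem apply (h : Provable (imp φ ψ)) (hφ : φ ∈ w) : ψ ∈ w := w.isTheory.mp (w.thm h) hφ

theorem neg_mem : neg φ ∈ w ↔ φ ∉ w := w.neg_mem_iff' φ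

theorem and_mem : and φ ψ ∈ w ↔ φ ∈ w ∧ ψ ∈ w :=
  ⟨fun h => ⟨w.apply (.and_left _ _) h, w.apply (.and_right _ _) h⟩,
    fun h => w.isTheory.mp (w.apply (.and_intro _ _) h.1) h.2⟩

theorem imp_mem : imp φ ψ ∈ w ↔ (φ ∈ w → ψ ∈ w) := by
  simp only [imp, neg_mem, and_mem]; tauto

theorem or_mem : or φ ψ ∈ w ↔ φ ∈ w ∨ ψ ∈ w := by
  simp only [Formula.or, neg_mem, and_mem]; tauto

theorem iff_mem : iff φ ψ ∈ w ↔ (φ ∈ w ↔ ψ ∈ w) := by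
  simp only [Formula.iff, imp_mem, and_mem]; tauto

theorem bot_notMem : bot ∉ w := by
  simp only [bot, ne, neg_mem, not_not]; exact w.thm (.eq_refl 0)

theorem top_mem : top ∈ w := by
  simp only [top, neg_mem]; exact bot_notMem

theorem ext_of_subset (h : ∀ φ ∈ u, φ ∈ w) : u = w := by
  have : u.carrier = w.carrier := by
    refine Set.Subset.antisymm h fun φ hφ => ?_
    by_contra hn
    exact neg_mem.1 (h _ (neg_mem.2 hn)) hφ
  cases u; cases w; cases this; rfl

end World

open World

theorem provable_iff_iff {φ ψ : Formula} :
    Provable (iff φ ψ) ↔ ∀ w : World, φ ∈ w ↔ ψ ∈ w := by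
  simp only [provable_iff_forall_mem, iff_mem]

theorem provable_imp_iff {φ ψ : Formula} :
    Provable (imp φ ψ) ↔ ∀ w : World, φ ∈ w → ψ ∈ w := by
  simp only [provable_iff_forall_mem, imp_mem]

/-- A monotone, additive and strict predicate that holds of `⊤` holds throughout some world. -/
theorem exists_world_forall {P : Formula → Prop}
    (mono : ∀ {φ ψ}, Provable (imp φ ψ) → P φ → P ψ)
    (add : ∀ {φ ψ}, P (or φ ψ) → P φ ∨ P ψ) (strict : ¬ P bot) (total : P top) :
    ∃ w : World, ∀ φ ∈ w, P φ := by
  -- The dual of `P` is a theory: additivity gives modus ponens, since the negation of `ψ` entails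
  -- that `φ ⇒ ψ` or `φ` fails. Any world extending it lies inside `P`.
  have hT : IsTheory {φ | ¬ P (neg φ)} := by
    refine ⟨fun {φ} h hP => strict (mono (provable_imp_iff.2 fun w hw => ?_) hP),
      fun {φ ψ} h h' hP => (add (φ := neg (imp φ ψ)) (ψ := neg φ)
        (mono (provable_imp_iff.2 fun w hw => ?_) hP)).elim h h'⟩
    · exact absurd (w.thm h) (neg_mem.1 hw)
    · simp only [or_mem, neg_mem, imp_mem] at hw ⊢
      tauto
  obtain ⟨w, hw, -⟩ := hT.exists_world (φ := bot) (fun h => h total)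
  refine ⟨w, fun φ hφ => ?_⟩
  by_contra hn
  refine neg_mem.1 (hw (a := neg φ) fun h => hn (mono (provable_imp_iff.2 fun w hw => ?_) h)) hφ
  simpa only [neg_mem, not_not] using hw

/-! ### Separation in the canonical model -/

theorem World.star_comm_mem {w : World} {φ ψ : Formula} :
    star φ ψ ∈ w ↔ star ψ φ ∈ w := iff_mem.1 (w.thm (.star_comm φ ψ))

theorem World.star_mono {w : World} {φ φ' ψ ψ' : Formula}
    (hφ : ∀ w : World, φ ∈ w → φ' ∈ w) (hψ : ∀ w : World, ψ ∈ w → ψ' ∈ w)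
    (h : star φ ψ ∈ w) : star φ' ψ' ∈ w :=
  star_comm_mem.1 (w.apply (.star_intro _ _ _ (provable_imp_iff.2 hψ))
    (star_comm_mem.1 (w.apply (.star_intro _ _ _ (provable_imp_iff.2 hφ)) h)))

theorem World.star_notMem_left {w : World} {φ ψ : Formula} (hφ : ∀ w : World, φ ∉ w) :
    star φ ψ ∉ w := fun h =>
  bot_notMem ((iff_mem.1 (w.thm (.star_bot ψ))).1
    (star_mono (fun w hw => absurd hw (hφ w)) (fun _ h => h) h))

theorem World.star_notMem_right {w : World} {φ ψ : Formula} (hψ : ∀ w : World, ψ ∉ w) :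
    star φ ψ ∉ w := fun h => star_notMem_left hψ (star_comm_mem.1 h)

theorem World.star_or_mem {w : World} {φ ψ χ : Formula} (h : star (or φ ψ) χ ∈ w) :
    star φ χ ∈ w ∨ star ψ χ ∈ w := or_mem.1 (w.apply (.star_or _ _ _) h)

/-- The world `w` splits into `u` and `v`. -/
def Splits (w u v : World) : Prop := ∀ φ ∈ u, ∀ ψ ∈ v, star φ ψ ∈ w

/-- The existence lemma of the canonical model. The world `u` is chosen so that all its members are
compatible with `ψ`, and then `v` so that all its members are compatible with all of `u`. -/
theorem exists_splits {w : World} {φ ψ : Formula} (h : star φ ψ ∈ w) :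
    ∃ u v, Splits w u v ∧ φ ∈ u ∧ ψ ∈ v := by
  obtain ⟨u, hu⟩ := exists_world_forall (P := fun c => star (and φ c) ψ ∈ w)
    (fun hcd => star_mono (fun w hw =>
      and_mem.2 ⟨(and_mem.1 hw).1, w.apply hcd (and_mem.1 hw).2⟩) fun _ h => h)
    (fun {c d} hcd => star_or_mem (star_mono (φ' := or (and φ c) (and φ d))
      (fun w hw => by simp only [or_mem, and_mem] at hw ⊢; tauto) (fun _ h => h) hcd))
    (star_notMem_left fun w hw => bot_notMem (and_mem.1 hw).2)
    (star_mono (fun w hw => and_mem.2 ⟨hw, top_mem⟩) (fun _ h => h) h)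
  have hφ : φ ∈ u := by
    by_contra hn
    exact star_notMem_left (fun w hw => neg_mem.1 (and_mem.1 hw).2 (and_mem.1 hw).1)
      (hu _ (neg_mem.2 hn))
  obtain ⟨v, hv⟩ := exists_world_forall (P := fun c => ∀ a ∈ u, star a (and ψ c) ∈ w)
    (fun hcd h a ha => star_mono (fun _ h => h) (fun w hw =>
      and_mem.2 ⟨(and_mem.1 hw).1, w.apply hcd (and_mem.1 hw).2⟩) (h a ha))
    (by
      intro c d hcd
      by_contra! hn
      -- The two failures have different witnesses in `u`; their conjunction is still in `u` and
      -- refutes both disjuncts at once.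
      obtain ⟨⟨a, ha, hac⟩, b, hb, hbd⟩ := hn
      have h := star_comm_mem.1 (star_mono (fun _ h => h)
        (ψ' := or (and ψ c) (and ψ d))
        (fun w hw => by simp only [or_mem, and_mem] at hw ⊢; tauto)
        (hcd (and a b) (and_mem.2 ⟨ha, hb⟩)))
      rcases star_or_mem h with h | h
      · exact hac (star_comm_mem.1 (star_mono (fun _ h => h) (fun _ h => (and_mem.1 h).1) h))
      · exact hbd (star_comm_mem.1 (star_mono (fun _ h => h) (fun _ h => (and_mem.1 h).2) h)))
    (fun h => star_notMem_right (fun w hw => bot_notMem (and_mem.1 hw).2) (h φ hφ))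
    (fun a ha => star_mono (fun w hw => (and_mem.1 hw).2)
      (fun w hw => and_mem.2 ⟨hw, top_mem⟩) (hu a ha))
  refine ⟨u, v, fun a ha b hb => star_mono (fun _ h => h) (fun w hw => (and_mem.1 hw).2)
    (hv b hb a ha), hφ, ?_⟩
  by_contra hn
  exact star_notMem_right (fun w hw => neg_mem.1 (and_mem.1 hw).2 (and_mem.1 hw).1)
    (hv _ (neg_mem.2 hn) φ hφ)

/-! ### The axioms read as properties of splittings -/

namespace Splits

variable {w u v u₁ u₂ v₁ v₂ : World} {x y : PVar} {n m : ℕ}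

theorem symm (h : Splits w u v) : Splits w v u :=
  fun a ha b hb => star_comm_mem.1 (h b hb a ha)

/-- The intermediate world `t` must contain every `star b d` with `b ∈ u₂` and `d ∈ v`, and be
compatible with `u₁`. Both demands are built into the predicate from which `t` is extracted. -/
theorem assoc (h : Splits w u v) (hu : Splits u u₁ u₂) :
    ∃ t, Splits t u₂ v ∧ Splits w u₁ t := by
  obtain ⟨t, ht⟩ := exists_world_forall
    (P := fun c => ∀ a ∈ u₁, ∀ b ∈ u₂, ∀ d ∈ v, star a (and c (star b d)) ∈ w)
    (fun hcd h a ha b hb d hd => star_mono (fun _ h => h) (fun w hw =>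
      and_mem.2 ⟨w.apply hcd (and_mem.1 hw).1, (and_mem.1 hw).2⟩) (h a ha b hb d hd))
    (by
      intro c c' hc
      by_contra! hn
      obtain ⟨⟨a, ha, b, hb, d, hd, hn⟩, a', ha', b', hb', d', hd', hn'⟩ := hn
      have h := star_comm_mem.1 (star_mono (fun _ h => h)
        (ψ' := or (and c (star b d)) (and c' (star b' d')))
        (fun w hw => by
          obtain ⟨hc, hs⟩ := and_mem.1 hw
          have h₁ := star_mono (fun _ h => (and_mem.1 h).1) (fun _ h => (and_mem.1 h).1) hs
          have h₂ := star_mono (fun _ h => (and_mem.1 h).2) (fun _ h => (and_mem.1 h).2) hs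
          simp only [or_mem, and_mem] at hc ⊢
          tauto)
        (hc (and a a') (and_mem.2 ⟨ha, ha'⟩) (and b b') (and_mem.2 ⟨hb, hb'⟩) (and d d')
          (and_mem.2 ⟨hd, hd'⟩)))
      rcases star_or_mem h with h | h
      · exact hn (star_comm_mem.1 (star_mono (fun _ h => h) (fun _ h => (and_mem.1 h).1) h))
      · exact hn' (star_comm_mem.1 (star_mono (fun _ h => h) (fun _ h => (and_mem.1 h).2) h)))
    (fun h => star_notMem_right (fun w hw => bot_notMem (and_mem.1 hw).1)
      (h top top_mem top top_mem top top_mem))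
    (fun a ha b hb d hd => star_mono (fun _ h => h) (fun w hw => and_mem.2 ⟨top_mem, hw⟩)
      ((iff_mem.1 (w.thm (.star_assoc a b d))).1 (h _ (hu a ha b hb) d hd)))
  refine ⟨t, fun b hb d hd => ?_, fun a ha c hc => star_mono (fun _ h => h)
    (fun w hw => (and_mem.1 hw).1) (ht c hc a ha top top_mem top top_mem)⟩
  by_contra hn
  exact star_notMem_right (fun w hw => neg_mem.1 (and_mem.1 hw).1 (and_mem.1 hw).2)
    (ht _ (neg_mem.2 hn) top top_mem b hb d hd)

theorem assoc' (h : Splits w u v) (hv : Splits v v₁ v₂) :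
    ∃ t, Splits t u v₁ ∧ Splits w t v₂ := by
  obtain ⟨t, ht, hw⟩ := h.symm.assoc hv.symm
  exact ⟨t, ht.symm, hw.symm⟩

theorem left_of_star_top {φ : Formula} (h : Splits w u v)
    (hφ : Provable (imp (star φ top) φ)) (hu : φ ∈ u) : φ ∈ w :=
  w.apply hφ (h φ hu top top_mem)

theorem eq_mem (h : Splits w u v) : eq x y ∈ u ↔ eq x y ∈ w := by
  refine ⟨h.left_of_star_top (.mono_eq x y), fun hw => ?_⟩
  by_contra hn
  exact neg_mem.1 (h.left_of_star_top (.mono_ne x y) (neg_mem.2 hn)) hw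

theorem alloc_mem (h : Splits w u v) : alloc x ∈ w ↔ alloc x ∈ u ∨ alloc x ∈ v := by
  refine ⟨fun hw => ?_, fun hx => hx.elim (h.left_of_star_top (.star_alloc x))
    (h.symm.left_of_star_top (.star_alloc x))⟩
  by_contra! hn
  exact neg_mem.1 (w.apply (.alloc_neg x) (h _ (neg_mem.2 hn.1) _ (neg_mem.2 hn.2))) hw

theorem alloc_disjoint (h : Splits w u v) (hu : alloc x ∈ u) (hv : alloc x ∈ v) : False :=
  bot_notMem ((iff_mem.1 (w.thm (.double_alloc x))).1 (h _ hu _ hv))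

theorem pointsTo_mem (h : Splits w u v) (hu : alloc x ∈ u) :
    pointsTo x y ∈ u ↔ pointsTo x y ∈ w := by
  refine ⟨h.left_of_star_top (.mono_pointsTo x y), fun hw => ?_⟩
  by_contra hn
  exact neg_mem.1 (w.apply (.pointsTo_neg x y)
    (h _ (and_mem.2 ⟨hu, neg_mem.2 hn⟩) top top_mem)) hw

theorem sizeGe_mem_of_right : ∀ {m : ℕ} {w u v : World},
    Splits w u v → sizeGe m ∈ v → sizeGe m ∈ w
  | 0, _, _, _, _, _ => top_mem
  | 1, _, _, _, h, hv => h.symm.left_of_star_top .mono_not_emp hv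
  | m + 2, w, u, v, h, hv => by
    obtain ⟨v₁, v₂, hs, h₁, h₂⟩ := exists_splits hv
    obtain ⟨t, ht, hw⟩ := h.symm.assoc hs
    exact hw _ h₁ _ (sizeGe_mem_of_right (m := m + 1) ht.symm h₂)

theorem sizeGe_add_mem : ∀ {n m : ℕ} {w u v : World},
    Splits w u v → sizeGe n ∈ u → sizeGe m ∈ v → sizeGe (n + m) ∈ w
  | 0, m, _, _, _, h, _, hv => by rw [zero_add]; exact h.sizeGe_mem_of_right hv
  | 1, 0, _, _, _, h, hu, _ => h.symm.sizeGe_mem_of_right hu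
  | 1, m + 1, _, _, _, h, hu, hv => by
    rw [add_comm 1]
    exact h _ hu _ hv
  | n + 2, m, w, u, v, h, hu, hv => by
    obtain ⟨u₁, u₂, hs, h₁, h₂⟩ := exists_splits hu
    obtain ⟨t, ht, hw⟩ := h.assoc hs
    have := ht.sizeGe_add_mem (n := n + 1) h₂ hv
    rw [show n + 2 + m = n + m + 2 by omega]
    rw [show n + 1 + m = n + m + 1 by omega] at this
    exact hw _ h₁ _ this

theorem sizeGe_add_notMem (h : Splits w u v) (hu : sizeGe n ∉ u) (hv : sizeGe m ∉ v) :
    sizeGe (n + m - 1) ∉ w :=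
  neg_mem.1 (w.apply (.size_neg n m) (h _ (neg_mem.2 hu) _ (neg_mem.2 hv)))

/-- A part of size at most one accounts for at most one cell, by `size_neg` with bounds `2` and `n`.
-/
theorem sizeGe_mem_of_succ (h : Splits w u v) (hu : sizeGe 2 ∉ u) (hw : sizeGe (n + 1) ∈ w) :
    sizeGe n ∈ v := by
  by_contra hn
  have := h.sizeGe_add_notMem hu hn
  rw [show 2 + n - 1 = n + 1 by omega] at this
  exact this hw

theorem sizeGe_succ_notMem (h : Splits w u v) (hu : sizeGe 2 ∉ u) (hv : sizeGe n ∉ v) :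
    sizeGe (n + 1) ∉ w := fun hw => hv (h.sizeGe_mem_of_succ hu hw)

end Splits

/-! ### Sizes, equality and cells inside a world -/

namespace World

variable {w : World} {x y z : PVar} {n m : ℕ}

theorem sizeGe_pred : ∀ {n : ℕ} {w : World}, sizeGe (n + 1) ∈ w → sizeGe n ∈ w
  | 0, _, _ => top_mem
  | 1, _, h => by
    obtain ⟨u, v, hs, hu, -⟩ := exists_splits h
    exact hs.left_of_star_top .mono_not_emp hu
  | n + 2, _, h => by
    obtain ⟨u, v, hs, hu, hv⟩ := exists_splits h
    exact hs _ hu _ (sizeGe_pred (n := n + 1) hv)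

theorem sizeGe_of_le (hnm : n ≤ m) (h : sizeGe m ∈ w) : sizeGe n ∈ w := by
  induction hnm with
  | refl => exact h
  | step _ ih => exact ih (sizeGe_pred h)

/-- Splitting `top * emp` leaves a first part contained in `w` by the unit axiom, and inclusion
between worlds is equality. -/
theorem exists_emp_splits (w : World) : ∃ u, Splits w u w ∧ emp ∈ u := by
  obtain ⟨v, u, h, -, hu⟩ := exists_splits
    ((iff_mem.1 (w.thm (.star_emp top))).1 top_mem)
  have : v = w := ext_of_subset fun φ hφ =>
    (iff_mem.1 (w.thm (.star_emp φ))).2 (h φ hφ emp hu)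
  exact ⟨u, this ▸ h.symm, hu⟩

/-- The substitution axiom goes one way only; applied to the negation of `φ` it gives the other. -/
theorem eq_subst_mem (h : eq x y ∈ w) (φ : Formula) : φ.subst x y ∈ w ↔ φ ∈ w := by
  refine ⟨fun hs => ?_, fun hφ => w.apply (.eq_subst φ x y) (and_mem.2 ⟨hφ, h⟩)⟩
  by_contra hn
  exact neg_mem.1 (w.apply (.eq_subst (neg φ) x y) (and_mem.2 ⟨neg_mem.2 hn, h⟩)) hs

theorem eq_symm (h : eq x y ∈ w) : eq y x ∈ w := by
  rw [← eq_subst_mem h]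
  simpa [subst] using w.thm (.eq_refl x)

theorem eq_trans (h : eq x y ∈ w) (h' : eq y z ∈ w) : eq x z ∈ w := by
  -- If `z` is `y`, the substitution would rewrite both sides of `eq y z` and give only `eq x x`.
  by_cases hz : z = y
  · rwa [hz]
  · simpa [subst, hz] using (eq_subst_mem h (eq y z)).2 h'

theorem alloc_mem_congr (h : eq x y ∈ w) : alloc x ∈ w ↔ alloc y ∈ w := by
  simpa [subst] using eq_subst_mem h (alloc y)

theorem alloc_mem_of_pointsTo (h : pointsTo x y ∈ w) : alloc x ∈ w :=
  w.apply (.pointsTo_alloc x y) h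

theorem exists_alloc_cell (h : alloc x ∈ w) :
    ∃ c w', Splits w c w' ∧ alloc x ∈ c ∧ sizeGe 1 ∈ c ∧ sizeGe 2 ∉ c := by
  obtain ⟨c, w', hs, hc, -⟩ := exists_splits (w.apply (.alloc_size_one x) h)
  simp only [and_mem, sizeEq, neg_mem] at hc
  exact ⟨c, w', hs, hc.1, hc.2⟩

theorem alloc_notMem_of_emp (h : emp ∈ w) : alloc x ∉ w := fun hx => by
  obtain ⟨c, w', hs, -, hc, -⟩ := exists_alloc_cell hx
  exact neg_mem.1 (hs.symm.sizeGe_mem_of_right hc) h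

theorem exists_cell (h : sizeGe 1 ∈ w) :
    ∃ c w', Splits w c w' ∧ sizeGe 1 ∈ c ∧ sizeGe 2 ∉ c := by
  obtain ⟨c, w', hs, hc, -⟩ := exists_splits (w.apply .size_one h)
  simp only [and_mem, sizeEq, neg_mem] at hc
  exact ⟨c, w', hs, hc⟩

theorem eq_mem_of_alloc (hx : alloc x ∈ w) (hy : alloc y ∈ w) (h : sizeGe 2 ∉ w) :
    eq x y ∈ w := by
  by_contra hn
  exact h (w.apply (.size_two x y) (and_mem.2 ⟨and_mem.2 ⟨hx, hy⟩, neg_mem.2 hn⟩))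

/-- One cell is carved off for each variable. A cell of size one cannot allocate two unequal
variables (`size_two`), so the other variables remain allocated in the rest. -/
theorem sizeGe_card_mem (S : Finset PVar) : ∀ {w : World},
    (∀ x ∈ S, ∀ y ∈ S, x ≠ y → eq x y ∉ w) → (∀ x ∈ S, alloc x ∈ w) → sizeGe S.card ∈ w := by
  induction S using Finset.induction_on with
  | empty => exact fun _ _ => top_mem
  | insert a S ha ih =>
    intro w hne hal
    obtain ⟨c, w', hs, hac, hc, hc'⟩ := exists_alloc_cell (hal a (Finset.mem_insert_self a S))
    rw [Finset.card_insert_of_notMem ha, add_comm]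
    refine hs.sizeGe_add_mem hc (ih (fun x hx y hy hxy => ?_) fun x hx => ?_)
    · rw [hs.symm.eq_mem]
      exact hne x (Finset.mem_insert_of_mem hx) y (Finset.mem_insert_of_mem hy) hxy
    · refine (hs.alloc_mem.1 (hal x (Finset.mem_insert_of_mem hx))).resolve_left fun hxc => ?_
      exact hne a (Finset.mem_insert_self a S) x (Finset.mem_insert_of_mem hx)
        (fun h => ha (h ▸ hx)) (hs.eq_mem.1 (eq_mem_of_alloc hac hxc hc'))

end World

/-! ### Splitting a world along its allocated variables -/

/-- On `X`, the kernel of `f` is the equality of the world `w`. -/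
def Represents (X : Finset PVar) (f : PVar → PVar) (w : World) : Prop :=
  ∀ x ∈ X, ∀ y ∈ X, eq x y ∈ w ↔ f x = f y

/-- The variables of `X` that `w` allocates are those with value in `A`. -/
def AllocatesExactly (X : Finset PVar) (f : PVar → PVar) (A : Finset PVar) (w : World) : Prop :=
  ∀ x ∈ X, alloc x ∈ w ↔ f x ∈ A

section Splitting

variable {X : Finset PVar} {f : PVar → PVar} {A B : Finset PVar} {w u v : World}

theorem Represents.left (hf : Represents X f w) (h : Splits w u v) : Represents X f u :=
  fun x hx y hy => h.eq_mem.trans (hf x hx y hy)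

theorem Represents.right (hf : Represents X f w) (h : Splits w u v) : Represents X f v :=
  hf.left h.symm

theorem AllocatesExactly.union (hA : AllocatesExactly X f A u) (hB : AllocatesExactly X f B v)
    (h : Splits w u v) : AllocatesExactly X f (A ∪ B) w := fun x hx => by
  rw [h.alloc_mem, hA x hx, hB x hx, Finset.mem_union]

/-- Size one confines the cell to the class of `x`, and disjointness of allocation removes exactly
that class from the rest. -/
theorem exists_cell_of_mem (hf : Represents X f w) (hA : AllocatesExactly X f A w) {a : PVar}
    (ha : a ∈ A) (haX : a ∈ X.image f) :
    ∃ c w', Splits w c w' ∧ sizeGe 1 ∈ c ∧ sizeGe 2 ∉ c ∧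
      AllocatesExactly X f {a} c ∧ AllocatesExactly X f (A.erase a) w' := by
  obtain ⟨x, hx, rfl⟩ := Finset.mem_image.1 haX
  obtain ⟨c, w', hs, hxc, hc, hc'⟩ := exists_alloc_cell ((hA x hx).2 ha)
  have key : AllocatesExactly X f {f x} c := fun y hy => by
    rw [Finset.mem_singleton]
    constructor
    · intro h
      exact ((hf.left hs) y hy x hx).1 (eq_mem_of_alloc h hxc hc')
    · intro h
      exact (alloc_mem_congr (((hf.left hs) y hy x hx).2 h)).2 hxc
  refine ⟨c, w', hs, hc, hc', key, fun y hy => ?_⟩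
  have hy' := key y hy
  rw [Finset.mem_singleton] at hy'
  rw [Finset.mem_erase, ← hA y hy, hs.alloc_mem, Ne, ← hy']
  have := hs.alloc_disjoint (x := y)
  tauto

/-- A world with more cells than allocated classes has an anonymous cell: the named cells are set
aside one at a time, a cell is taken from what remains, and the named ones are put back by
associativity. -/
theorem exists_cell_of_card_lt : ∀ {n : ℕ} {A : Finset PVar} {w : World}, A.card = n →
    Represents X f w → AllocatesExactly X f A w → A ⊆ X.image f → sizeGe (n + 1) ∈ w →
    ∃ c w', Splits w c w' ∧ sizeGe 1 ∈ c ∧ sizeGe 2 ∉ c ∧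
      AllocatesExactly X f ∅ c ∧ AllocatesExactly X f A w'
  | 0, A, w, hn, _, hA, _, hw => by
    obtain rfl := Finset.card_eq_zero.1 hn
    obtain ⟨c, w', hs, hc⟩ := exists_cell hw
    have : ∀ x ∈ X, ¬ (alloc x ∈ c ∨ alloc x ∈ w') := fun x hx h => by
      simpa using (hA x hx).1 (hs.alloc_mem.2 h)
    refine ⟨c, w', hs, hc.1, hc.2, fun x hx => ?_, fun x hx => ?_⟩ <;>
    · have := this x hx
      simp only [Finset.notMem_empty]
      tauto
  | n + 1, A, w, hn, hf, hA, hAX, hw => by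
    obtain ⟨a, ha⟩ := Finset.card_pos.1 (by omega : 0 < A.card)
    obtain ⟨d, w₁, hs, hd, hd', hda, hw₁⟩ := exists_cell_of_mem hf hA ha (hAX ha)
    obtain ⟨c, w₂, hs', hc, hc', hc₀, hw₂⟩ := exists_cell_of_card_lt (n := n)
      (by rw [Finset.card_erase_of_mem ha]; omega) (hf.right hs) hw₁
      ((Finset.erase_subset a A).trans hAX) (hs.sizeGe_mem_of_succ hd' hw)
    obtain ⟨t, ht, hwt⟩ := hs.symm.assoc hs'
    refine ⟨c, t, hwt, hc, hc', hc₀, ?_⟩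
    have := hda.union hw₂ ht.symm
    rwa [← Finset.insert_eq, Finset.insert_erase ha] at this

/-- Cells move into `u` one by one, named ones while `A` lasts and anonymous ones afterwards. The
size of `u` is thus exactly `n`, whereas `v` receives all the rest and is only bounded below. -/
theorem exists_splits_allocates : ∀ {n m : ℕ} {A : Finset PVar} {w : World},
    Represents X f w → AllocatesExactly X f (A ∪ B) w → Disjoint A B → A ∪ B ⊆ X.image f →
    A.card ≤ n → B.card ≤ m → sizeGe (n + m) ∈ w →
    ∃ u v, Splits w u v ∧ AllocatesExactly X f A u ∧ AllocatesExactly X f B v ∧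
      sizeGe n ∈ u ∧ sizeGe (n + 1) ∉ u ∧ sizeGe m ∈ v
  | 0, m, A, w, _, hAB, _, _, hn, _, hw => by
    obtain rfl := Finset.card_eq_zero.1 (Nat.le_zero.1 hn)
    obtain ⟨u, hs, hu⟩ := w.exists_emp_splits
    refine ⟨u, w, hs, fun x _ => ?_, by simpa using hAB, top_mem,
      fun h => neg_mem.1 h hu, by simpa using hw⟩
    simp [alloc_notMem_of_emp hu]
  | n + 1, m, A, w, hf, hAB, hd, hX, hn, hm, hw => by
    have step : ∃ C A' c w', Splits w c w' ∧ sizeGe 1 ∈ c ∧ sizeGe 2 ∉ c ∧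
        AllocatesExactly X f C c ∧ AllocatesExactly X f (A' ∪ B) w' ∧ C ∪ A' = A ∧
        A'.card ≤ n := by
      rcases A.eq_empty_or_nonempty with rfl | ⟨a, ha⟩
      -- An anonymous cell is available because `B` has at most `m` classes while the world has at
      -- least `n + 1 + m` cells.
      · obtain ⟨c, w', hs, hc, hc', hc₀, hw'⟩ := exists_cell_of_card_lt (n := B.card)
          (by simp) hf hAB hX (sizeGe_of_le (by omega) hw)
        exact ⟨∅, ∅, c, w', hs, hc, hc', hc₀, hw', by simp, by simp⟩
      · obtain ⟨c, w', hs, hc, hc', hca, hw'⟩ := exists_cell_of_mem hf hAB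
          (Finset.mem_union_left B ha) (hX (Finset.mem_union_left B ha))
        rw [Finset.erase_union_distrib,
          Finset.erase_eq_of_notMem (Finset.disjoint_left.1 hd ha)] at hw'
        refine ⟨{a}, A.erase a, c, w', hs, hc, hc', hca, hw', ?_, ?_⟩
        · rw [← Finset.insert_eq, Finset.insert_erase ha]
        · rw [Finset.card_erase_of_mem ha]; omega
    obtain ⟨C, A', c, w', hs, hc, hc', hC, hw', rfl, hA'⟩ := step
    obtain ⟨u', v, hs', hu', hv, hn₁, hn₂, hm'⟩ := exists_splits_allocates (hf.right hs) hw'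
      (hd.mono_left Finset.subset_union_right)
      ((Finset.union_subset_union_left Finset.subset_union_right).trans hX) hA' hm
      (hs.sizeGe_mem_of_succ hc' (by rwa [show n + m + 1 = n + 1 + m by omega]))
    obtain ⟨u, hu, hwu⟩ := hs.assoc' hs'
    refine ⟨u, v, hwu, hC.union hu' hu, hv, ?_, hu.sizeGe_succ_notMem hc' hn₂, hm'⟩
    rw [add_comm]
    exact hu.sizeGe_add_mem hc hn₁

end Splitting

/-- Each variable is sent to the least variable of `X` equal to it in `w`. -/
theorem Represents.exists (X : Finset PVar) (w : World) :
    ∃ f, Represents X f w ∧ ∀ x ∈ X, f x ∈ X ∧ eq x (f x) ∈ w := by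
  have key : ∀ x ∈ X, sInf {y | y ∈ X ∧ eq x y ∈ w} ∈ {y | y ∈ X ∧ eq x y ∈ w} :=
    fun x hx => Nat.sInf_mem ⟨x, hx, w.thm (.eq_refl x)⟩
  refine ⟨fun x => sInf {y | y ∈ X ∧ eq x y ∈ w}, fun x hx y hy => ⟨fun h => ?_, fun h => ?_⟩,
    key⟩
  · have : {z | z ∈ X ∧ eq x z ∈ w} = {z | z ∈ X ∧ eq y z ∈ w} := by
      ext z
      exact and_congr_right fun _ => ⟨eq_trans (eq_symm h), eq_trans h⟩
    simp only [this]
  · have hx' := (key x hx).2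
    have hy' := (key y hy).2
    simp only at h
    rw [← h] at hy'
    exact eq_trans hx' (eq_symm hy')

/-! ### Coherence of core types -/

theorem World.conj_mem {w : World} : ∀ {L : List Literal},
    conj L ∈ w ↔ ∀ l ∈ L, l.toFormula ∈ w
  | [] => by simpa [conj] using top_mem
  | [l] => by simp [conj]
  | l :: l' :: L => by
    rw [conj, and_mem, conj_mem (L := l' :: L)]
    simp only [List.mem_cons, forall_eq_or_imp]

theorem satisfies_conj {s : Store} {h : Heap} : ∀ {L : List Literal},
    Satisfies s h (conj L) ↔ ∀ l ∈ L, Satisfies s h l.toFormula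
  | [] => by simp [conj, Satisfies, top, bot, ne]
  | [l] => by simp [conj]
  | l :: l' :: L => by
    rw [conj, Satisfies, satisfies_conj (L := l' :: L)]
    simp only [List.mem_cons, forall_eq_or_imp]

theorem satisfies_sizeGe {s : Store} : ∀ {n : ℕ} {h : Heap},
    Satisfies s h (sizeGe n) ↔ n ≤ h.keys.card
  | 0, h => by simp [sizeGe, Satisfies, top, bot, ne]
  | 1, h => by
    rw [sizeGe, Satisfies, Satisfies, Nat.one_le_iff_ne_zero, Ne, Finset.card_eq_zero]
  | n + 2, h => by
    rw [sizeGe, Satisfies]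
    constructor
    · rintro ⟨h₁, h₂, hd, rfl, hne, hn⟩
      have hc : 0 < h₁.keys.card := Finset.card_pos.2 (Finset.nonempty_iff_ne_empty.2 hne)
      have hn := (satisfies_sizeGe (n := n + 1)).1 hn
      rw [Finmap.keys_union, Finset.card_union_of_disjoint]
      · omega
      · exact Finset.disjoint_left.2 fun a ha => 
          fun ha' => hd a (Finmap.mem_keys.1 ha) (Finmap.mem_keys.1 ha')
    · intro hn
      obtain ⟨k, hk⟩ := Finset.card_pos.1 (by omega : 0 < h.keys.card)
      obtain ⟨b, hb⟩ := Finmap.mem_iff.1 (Finmap.mem_keys.1 hk)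
      refine ⟨Finmap.singleton k b, h.erase k, ?_, ?_, ?_, ?_⟩
      · intro a ha
        rw [Finmap.mem_singleton] at ha
        simp [ha, Finmap.mem_erase]
      · refine Finmap.ext_lookup fun a => ?_
        by_cases ha : a = k
        · subst ha
          rw [Finmap.lookup_union_left (by simp), hb, Finmap.lookup_singleton_eq]
        · rw [Finmap.lookup_union_right (by simpa using ha), Finmap.lookup_erase_ne ha]
      · simp [Satisfies, Finmap.keys_singleton]
      · rw [satisfies_sizeGe (n := n + 1), Finmap.keys_erase, Finset.card_erase_of_mem hk]
        omega

/-- The closure properties shared by the satisfiable core types over `X`. -/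
structure Coherent (X : Finset PVar) (φ : List Literal) : Prop where
  alloc_of_pointsTo : ∀ {x y}, .pos (.pointsTo x y) ∈ φ → .pos (.alloc x) ∈ φ
  alloc_congr : ∀ {x y}, .pos (.eq x y) ∈ φ → .pos (.alloc x) ∈ φ → .pos (.alloc y) ∈ φ
  lt_of_sizeGe : ∀ {n m}, .pos (.sizeGe n) ∈ φ → .neg (.sizeGe m) ∈ φ → n < m
  sizeGe_zero : .pos (.sizeGe 0) ∈ φ
  sizeGe_card : ∀ S ⊆ X, (∀ x ∈ S, ∀ y ∈ S, x ≠ y → .neg (.eq x y) ∈ φ) →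
    (∀ x ∈ S, .pos (.alloc x) ∈ φ) → .pos (.sizeGe S.card) ∈ φ

section CoreTypes

variable {X : Finset PVar} {α : ℕ} {φ ψ : List Literal}

theorem core_mem_of_mem (hφ : φ ∈ coreTypes X α) {l : Literal} (hl : l ∈ φ) :
    l.core ∈ coreFormulae X α := hφ.1 l hl

theorem pos_or_neg_mem (hφ : φ ∈ coreTypes X α) {c : CoreFormula} (hc : c ∈ coreFormulae X α) :
    .pos c ∈ φ ∨ .neg c ∈ φ := (hφ.2 c hc).1

theorem neg_notMem_of_pos_mem (hφ : φ ∈ coreTypes X α) {c : CoreFormula} (hc : .pos c ∈ φ) :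
    .neg c ∉ φ := fun h => (hφ.2 c (core_mem_of_mem hφ hc)).2 ⟨hc, h⟩

/-- The abstract `V` covers truth in a memory state and membership in a world. A core type decides
every core formula, so a valuation making its literals true turns each true core formula into a
positive literal; `hα` makes `sizeGe S.card` such a formula. -/
theorem Coherent.of_valuation (hα : X.card ≤ α) (hφ : φ ∈ coreTypes X α) {V : Formula → Prop}
    (hV : ∀ l ∈ φ, V l.toFormula) (hneg : ∀ χ, V (neg χ) → ¬ V χ)
    (hpt : ∀ x y, V (pointsTo x y) → V (alloc x))
    (heq : ∀ x y, V (eq x y) → V (alloc x) → V (alloc y))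
    (hle : ∀ n m, n ≤ m → V (sizeGe m) → V (sizeGe n)) (hzero : V (sizeGe 0))
    (hcard : ∀ S : Finset PVar, (∀ x ∈ S, ∀ y ∈ S, x ≠ y → ¬ V (eq x y)) →
      (∀ x ∈ S, V (alloc x)) → V (sizeGe S.card)) : Coherent X φ := by
  have pos_mem : ∀ c ∈ coreFormulae X α, V c.toFormula → .pos c ∈ φ := fun c hc h =>
    (pos_or_neg_mem hφ hc).resolve_right fun hn => hneg _ (hV _ hn) h
  refine ⟨fun {x y} h => pos_mem (.alloc x) (core_mem_of_mem hφ h).1 (hpt x y (hV _ h)),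
    fun {x y} h h' => pos_mem (.alloc y) (core_mem_of_mem hφ h).2 (heq x y (hV _ h) (hV _ h')),
    fun {n m} h h' => ?_, pos_mem (.sizeGe 0) (Nat.zero_le α) hzero, fun S hS hne hal =>
      pos_mem (.sizeGe S.card) ((Finset.card_le_card hS).trans hα)
        (hcard S (fun x hx y hy hxy => hneg _ (hV _ (hne x hx y hy hxy)))
          fun x hx => hV _ (hal x hx))⟩
  by_contra! hmn
  exact hneg _ (hV _ h') (hle _ _ hmn (hV _ h))

theorem Coherent.of_world (hα : X.card ≤ α) (hφ : φ ∈ coreTypes X α) {w : World}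
    (hw : conj φ ∈ w) : Coherent X φ :=
  .of_valuation hα hφ (V := (· ∈ w)) (conj_mem.1 hw) (fun _ => neg_mem.1)
    (fun _ _ => alloc_mem_of_pointsTo) (fun _ _ h => (alloc_mem_congr h).1)
    (fun _ _ => sizeGe_of_le) top_mem fun S => sizeGe_card_mem S

theorem Coherent.of_satisfiable (hα : X.card ≤ α) (hφ : φ ∈ coreTypes X α)
    (h : Satisfiable (conj φ)) : Coherent X φ := by
  obtain ⟨s, h, hs⟩ := h
  refine .of_valuation hα hφ (V := Satisfies s h) (satisfies_conj.1 hs) (fun _ h => h)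
    (fun x y h => Finmap.mem_keys.2 (Finmap.mem_of_lookup_eq_some h))
    (fun x y h => ?_) (fun n m hnm => ?_) (satisfies_sizeGe.2 (Nat.zero_le _))
    fun S hne hal => ?_
  · simp only [Satisfies] at h ⊢
    rw [h]
    exact id
  · rw [satisfies_sizeGe, satisfies_sizeGe]
    exact hnm.trans
  · rw [satisfies_sizeGe, ← Finset.card_image_of_injOn (f := s)]
    · exact Finset.card_le_card (Finset.image_subset_iff.2 hal)
    · intro x hx y hy hxy
      by_contra hn
      exact hne x hx y hy hn hxy

/-- When the greatest `n` equals `α` the type puts no upper bound on the size, hence the guard in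
the last clause. -/
theorem Coherent.exists_size (hc : Coherent X φ) (hφ : φ ∈ coreTypes X α) :
    ∃ n, .pos (.sizeGe n) ∈ φ ∧ (∀ β, .pos (.sizeGe β) ∈ φ → β ≤ n) ∧
      (n < α → .neg (.sizeGe (n + 1)) ∈ φ) := by
  classical
  let n := Nat.findGreatest (fun β => .pos (.sizeGe β) ∈ φ) α
  have hmax : ∀ β, .pos (.sizeGe β) ∈ φ → β ≤ n := fun β hβ =>
    Nat.le_findGreatest (core_mem_of_mem hφ hβ) hβ
  refine ⟨n, Nat.findGreatest_spec (P := fun β => .pos (.sizeGe β) ∈ φ) (Nat.zero_le α)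
    hc.sizeGe_zero, hmax, fun hn => (pos_or_neg_mem hφ (c := .sizeGe (n + 1)) hn).resolve_left
      fun h => ?_⟩
  have := hmax _ h
  omega

/-- The representatives of the variables that a core type allocates. -/
theorem Coherent.exists_allocated (hc : Coherent X φ) (hφ : φ ∈ coreTypes X α) {w : World}
    (hw : ∀ x y, (.pos (.eq x y) ∈ φ → eq x y ∈ w) ∧ (.neg (.eq x y) ∈ φ → eq x y ∉ w))
    {f : PVar → PVar} (hf : Represents X f w) (hfX : ∀ x ∈ X, f x ∈ X ∧ eq x (f x) ∈ w) :
    ∃ A ⊆ X.image f, (∀ x ∈ X, f x ∈ A ↔ .pos (.alloc x) ∈ φ) ∧ .pos (.sizeGe A.card) ∈ φ := by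
  classical
  have pos_eq : ∀ x ∈ X, ∀ y ∈ X, eq x y ∈ w → .pos (.eq x y) ∈ φ := fun x hx y hy h =>
    (pos_or_neg_mem hφ (c := .eq x y) ⟨hx, hy⟩).resolve_right fun hn => (hw x y).2 hn h
  -- Distinct representatives are unequal in `w`, since `f` fixes them; the type therefore holds the
  -- disequalities required by `sizeGe_card`.
  have idem : ∀ x ∈ X, f (f x) = f x := fun x hx =>
    ((hf x hx (f x) (hfX x hx).1).1 (hfX x hx).2).symm
  refine ⟨{x ∈ X | .pos (.alloc x) ∈ φ}.image f, Finset.image_subset_image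
    (Finset.filter_subset _ _), fun x hx => ⟨fun h => ?_, fun h => Finset.mem_image_of_mem f
      (Finset.mem_filter.2 ⟨hx, h⟩)⟩, hc.sizeGe_card _ ?_ ?_ ?_⟩
  · simp only [Finset.mem_image, Finset.mem_filter] at h
    obtain ⟨y, ⟨hy, hal⟩, hxy⟩ := h
    exact hc.alloc_congr (pos_eq y hy x hx ((hf y hy x hx).2 hxy)) hal
  · exact Finset.image_subset_iff.2 fun x hx => (hfX x (Finset.mem_filter.1 hx).1).1
  · simp only [Finset.mem_image, Finset.mem_filter]
    rintro _ ⟨x, ⟨hx, -⟩, rfl⟩ _ ⟨y, ⟨hy, -⟩, rfl⟩ hne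
    refine (pos_or_neg_mem hφ (c := .eq (f x) (f y))
      ⟨(hfX x hx).1, (hfX y hy).1⟩).resolve_left fun h => hne ?_
    rw [← idem x hx, ← idem y hy]
    exact (hf _ (hfX x hx).1 _ (hfX y hy).1).1 ((hw _ _).1 h)
  · simp only [Finset.mem_image, Finset.mem_filter]
    rintro _ ⟨x, ⟨hx, hal⟩, rfl⟩
    exact hc.alloc_congr (pos_eq x hx _ (hfX x hx).1 (hfX x hx).2) hal

/-- Points-to literals need checking only at allocated variables: a positive one forces allocation
by coherence, and a negative one at an unallocated variable is automatic. -/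
theorem Coherent.conj_mem (hc : Coherent X φ) (hφ : φ ∈ coreTypes X α) {w : World}
    (heq : ∀ x y, (.pos (.eq x y) ∈ φ → eq x y ∈ w) ∧ (.neg (.eq x y) ∈ φ → eq x y ∉ w))
    (hal : ∀ x ∈ X, alloc x ∈ w ↔ .pos (.alloc x) ∈ φ)
    (hpt : ∀ x y, .pos (.alloc x) ∈ φ → (.pos (.pointsTo x y) ∈ φ → pointsTo x y ∈ w) ∧
      (.neg (.pointsTo x y) ∈ φ → pointsTo x y ∉ w)) {n : ℕ} (hn : sizeGe n ∈ w)
    (hnφ : .pos (.sizeGe n) ∈ φ) (hmax : ∀ β, .pos (.sizeGe β) ∈ φ → β ≤ n)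
    (hn' : n < α → sizeGe (n + 1) ∉ w) : conj φ ∈ w := by
  refine World.conj_mem.2 fun l hl => ?_
  have hX := core_mem_of_mem hφ hl
  rcases l with (⟨x, y⟩ | x | ⟨x, y⟩ | β) | (⟨x, y⟩ | x | ⟨x, y⟩ | β)
  · exact (heq x y).1 hl
  · exact (hal x hX).2 hl
  · exact (hpt x y (hc.alloc_of_pointsTo hl)).1 hl
  · exact sizeGe_of_le (hmax β hl) hn
  · exact neg_mem.2 ((heq x y).2 hl)
  · exact neg_mem.2 fun h => neg_notMem_of_pos_mem hφ ((hal x hX).1 h) hl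
  · refine neg_mem.2 fun h => ?_
    exact (hpt x y ((hal x hX.1).1 (alloc_mem_of_pointsTo h))).2 hl h
  · have hβ := hc.lt_of_sizeGe hnφ hl
    exact neg_mem.2 fun h => hn' (hβ.trans_le hX) (sizeGe_of_le hβ h)

/-! ### The literals of a separating conjunction -/

theorem boxStar_comm : boxStar φ ψ = boxStar ψ φ := by
  ext l
  simp only [boxStar, Set.mem_union, Set.mem_ofPred_eq]
  constructor <;>
  · rintro (((((((⟨x, y, h, h'⟩ | ⟨x, h, h'⟩) | ⟨x, h, h'⟩) | ⟨x, y, h, h'⟩) | ⟨x, h, h'⟩) |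
      ⟨n, m, h, h'⟩) | ⟨x, y, h, h'⟩) | ⟨n, m, h, h'⟩)
    · exact .inl (.inl (.inl (.inl (.inl (.inl (.inl ⟨x, y, h, h'.symm⟩))))))
    · exact .inl (.inl (.inl (.inl (.inl (.inl (.inr ⟨x, h, h'.symm⟩))))))
    · exact .inl (.inl (.inl (.inl (.inl (.inr ⟨x, h, h'.symm⟩)))))
    · exact .inl (.inl (.inl (.inl (.inr ⟨x, y, h, h'.symm⟩))))
    · exact .inl (.inl (.inl (.inr ⟨x, h, h'.symm⟩)))
    · exact .inl (.inl (.inr ⟨m, n, by rw [add_comm, h], h'.symm⟩))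
    · exact .inl (.inr ⟨x, y, h, h'.symm⟩)
    · exact .inr ⟨m, n, by rw [add_comm, h], h'.symm⟩

theorem core_mem_of_mem_boxStar (hφ : φ ∈ coreTypes X α) (hψ : ψ ∈ coreTypes X α)
    {l : Literal} (hl : l ∈ boxStar φ ψ) : l.core ∈ coreFormulae X (2 * α) := by
  rcases hl with (((((((⟨x, y, rfl | rfl, h | h⟩ | ⟨x, rfl, h | h⟩) | ⟨x, rfl, h, -⟩) |
    ⟨x, y, rfl, ⟨-, h⟩ | ⟨-, h⟩⟩) | ⟨x, rfl, h, -⟩) | ⟨n, m, rfl, h, h'⟩) |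
    ⟨x, y, rfl, h | h⟩) | ⟨n, m, rfl, h, h'⟩)
  any_goals first | exact core_mem_of_mem hφ h | exact core_mem_of_mem hψ h
  · exact ⟨core_mem_of_mem hφ h, core_mem_of_mem hφ h⟩
  all_goals
    have hn : n ≤ α := core_mem_of_mem hφ h
    have hm : m ≤ α := core_mem_of_mem hψ h'
    simp only [Literal.core, coreFormulae, Set.mem_ofPred_eq]
    omega

theorem finite_coreFormulae (X : Finset PVar) (α : ℕ) : (coreFormulae X α).Finite := by
  refine ((((X ×ˢ X).finite_toSet.image fun p => CoreFormula.eq p.1 p.2).union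
    (X.finite_toSet.image CoreFormula.alloc)).union
    (((X ×ˢ X).finite_toSet.image fun p => CoreFormula.pointsTo p.1 p.2).union
    ((Set.finite_Iic α).image CoreFormula.sizeGe))).subset ?_
  rintro (⟨x, y⟩ | x | ⟨x, y⟩ | β) h
  · exact .inl (.inl ⟨(x, y), by simpa [coreFormulae] using h, rfl⟩)
  · exact .inl (.inr ⟨x, h, rfl⟩)
  · exact .inr (.inl ⟨(x, y), by simpa [coreFormulae] using h, rfl⟩)
  · exact .inr (.inr ⟨β, h, rfl⟩)

theorem finite_boxStar (hφ : φ ∈ coreTypes X α) (hψ : ψ ∈ coreTypes X α) :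
    (boxStar φ ψ).Finite := by
  refine (((finite_coreFormulae X (2 * α)).image Literal.pos).union
    ((finite_coreFormulae X (2 * α)).image Literal.neg)).subset fun l hl => ?_
  have := core_mem_of_mem_boxStar hφ hψ hl
  rcases l with c | c
  · exact .inl ⟨c, this, rfl⟩
  · exact .inr ⟨c, this, rfl⟩

theorem exists_literals_eq_boxStar (hφ : φ ∈ coreTypes X α) (hψ : ψ ∈ coreTypes X α) :
    ∃ χ, literals χ = boxStar φ ψ :=
  ⟨(finite_boxStar hφ hψ).toFinset.toList, by ext l; simp [literals]⟩

theorem boxStar_mem_of_star_mem {w : World} (hw : star (conj φ) (conj ψ) ∈ w) {l : Literal}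
    (hl : l ∈ boxStar φ ψ) : l.toFormula ∈ w := by
  obtain ⟨u, v, hs, hu, hv⟩ := exists_splits hw
  rw [conj_mem] at hu hv
  rcases hl with (((((((⟨x, y, rfl | rfl, h | h⟩ | ⟨x, rfl, h⟩) | ⟨x, rfl, h, h'⟩) |
    ⟨x, y, rfl, ⟨h, h'⟩ | ⟨h, h'⟩⟩) | ⟨x, rfl, h, h'⟩) | ⟨n, m, rfl, h, h'⟩) |
    ⟨x, y, rfl, h | h⟩) | ⟨n, m, rfl, h, h'⟩)
  · exact hs.eq_mem.1 (hu _ h)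
  · exact hs.symm.eq_mem.1 (hv _ h)
  · exact neg_mem.2 fun hw => neg_mem.1 (hu _ h) (hs.eq_mem.2 hw)
  · exact neg_mem.2 fun hw => neg_mem.1 (hv _ h) (hs.symm.eq_mem.2 hw)
  · exact hs.alloc_mem.2 (h.imp (hu _) (hv _))
  · exact neg_mem.2 fun hw =>
      (hs.alloc_mem.1 hw).elim (neg_mem.1 (hu _ h)) (neg_mem.1 (hv _ h'))
  · exact neg_mem.2 fun hw => neg_mem.1 (hu _ h') ((hs.pointsTo_mem (hu _ h)).2 hw)
  · exact neg_mem.2 fun hw => neg_mem.1 (hv _ h') ((hs.symm.pointsTo_mem (hv _ h)).2 hw)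
  · exact (hs.alloc_disjoint (hu _ h) (hv _ h')).elim
  · exact hs.sizeGe_add_mem (hu _ h) (hv _ h')
  · exact hs.left_of_star_top (.mono_pointsTo x y) (hu _ h)
  · exact hs.symm.left_of_star_top (.mono_pointsTo x y) (hv _ h)
  · exact neg_mem.2 (hs.sizeGe_add_notMem (neg_mem.1 (hu _ h)) (neg_mem.1 (hv _ h')))

/-! ### From the literals back to the separating conjunction -/

theorem star_mem_of_boxStar_mem (hφ : φ ∈ coreTypes X α) (hψ : ψ ∈ coreTypes X α)
    (cφ : Coherent X φ) (cψ : Coherent X ψ) {w : World}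
    (hw : ∀ l ∈ boxStar φ ψ, l.toFormula ∈ w) : star (conj φ) (conj ψ) ∈ w := by
  have heq : ∀ {φ ψ}, (∀ l ∈ boxStar φ ψ, l.toFormula ∈ w) → ∀ x y,
      (.pos (.eq x y) ∈ φ → eq x y ∈ w) ∧ (.neg (.eq x y) ∈ φ → eq x y ∉ w) := fun hw x y =>
    ⟨fun h => hw _ (.inl (.inl (.inl (.inl (.inl (.inl (.inl ⟨x, y, .inl rfl, .inl h⟩))))))),
      fun h => neg_mem.1
        (hw _ (.inl (.inl (.inl (.inl (.inl (.inl (.inl ⟨x, y, .inr rfl, .inl h⟩))))))))⟩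
  have hpt : ∀ {φ ψ}, (∀ l ∈ boxStar φ ψ, l.toFormula ∈ w) → ∀ x y, .pos (.alloc x) ∈ φ →
      (.pos (.pointsTo x y) ∈ φ → pointsTo x y ∈ w) ∧
      (.neg (.pointsTo x y) ∈ φ → pointsTo x y ∉ w) := fun hw x y hx =>
    ⟨fun h => hw _ (.inl (.inr ⟨x, y, rfl, .inl h⟩)), fun h => neg_mem.1
      (hw _ (.inl (.inl (.inl (.inl (.inr ⟨x, y, rfl, .inl ⟨hx, h⟩⟩))))))⟩
  have hw' : ∀ l ∈ boxStar ψ φ, l.toFormula ∈ w := by rwa [boxStar_comm]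
  obtain ⟨f, hf, hfX⟩ := Represents.exists X w
  obtain ⟨A, hAX, hA, hAφ⟩ := cφ.exists_allocated hφ (heq hw) hf hfX
  obtain ⟨B, hBX, hB, hBψ⟩ := cψ.exists_allocated hψ (heq hw') hf hfX
  obtain ⟨n, hn, hnmax, hn'⟩ := cφ.exists_size hφ
  obtain ⟨m, hm, hmmax, hm'⟩ := cψ.exists_size hψ
  have hsize : sizeGe (n + m) ∈ w := hw _ (.inl (.inl (.inr ⟨n, m, rfl, hn, hm⟩)))
  have hAB : AllocatesExactly X f (A ∪ B) w := fun x hx => by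
    rw [Finset.mem_union, hA x hx, hB x hx]
    refine ⟨fun h => ?_, fun h => hw _ (.inl (.inl (.inl (.inl (.inl (.inl (.inr
      ⟨x, rfl, h⟩)))))))⟩
    by_contra! hn
    exact neg_mem.1 (hw _ (.inl (.inl (.inl (.inl (.inl (.inr ⟨x, rfl,
      (pos_or_neg_mem hφ (c := .alloc x) hx).resolve_left hn.1,
      (pos_or_neg_mem hψ (c := .alloc x) hx).resolve_left hn.2⟩))))))) h
  -- A variable allocated in both types would put the absurd literal `x ≠ x` into `boxStar φ ψ`.
  have hdisj : Disjoint A B := Finset.disjoint_left.2 fun a ha hb => by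
    obtain ⟨x, hx, rfl⟩ := Finset.mem_image.1 (hAX ha)
    exact neg_mem.1 (hw _ (.inl (.inl (.inl (.inr ⟨x, rfl, (hA x hx).1 ha, (hB x hx).1 hb⟩)))))
      (w.thm (.eq_refl x))
  have hX : A ∪ B ⊆ X.image f := Finset.union_subset hAX hBX
  have split : ∃ u v, Splits w u v ∧ AllocatesExactly X f A u ∧ AllocatesExactly X f B v ∧
      sizeGe n ∈ u ∧ sizeGe m ∈ v ∧ (n < α → sizeGe (n + 1) ∉ u) ∧
      (m < α → sizeGe (m + 1) ∉ v) := by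
    -- Only one part can be given an exact size. If `φ` bounds its size, that part is `u`, and a
    -- bound on `v` follows from the literal refusing size `(n + 1) + (m + 1) - 1`. Otherwise `u`
    -- needs no bound and `v` gets the exact size.
    by_cases hnα : n < α
    · obtain ⟨u, v, hs, hu, hv, h₁, h₂, h₃⟩ := exists_splits_allocates hf hAB hdisj hX
        (hnmax _ hAφ) (hmmax _ hBψ) hsize
      refine ⟨u, v, hs, hu, hv, h₁, h₃, fun _ => h₂, fun hmα h => ?_⟩
      refine neg_mem.1 (hw _ (.inr ⟨n + 1, m + 1, rfl, hn' hnα, hm' hmα⟩)) ?_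
      exact sizeGe_of_le (by omega) (hs.sizeGe_add_mem h₁ h)
    · rw [Finset.union_comm] at hAB hX
      rw [add_comm] at hsize
      obtain ⟨v, u, hs, hv, hu, h₁, h₂, h₃⟩ := exists_splits_allocates hf hAB hdisj.symm hX
        (hmmax _ hBψ) (hnmax _ hAφ) hsize
      exact ⟨u, v, hs.symm, hu, hv, h₃, h₁, fun h => absurd h hnα, fun _ => h₂⟩
  obtain ⟨u, v, hs, hu, hv, hnu, hmv, hnu', hmv'⟩ := split
  have hu' : ∀ x ∈ X, alloc x ∈ u ↔ .pos (.alloc x) ∈ φ := fun x hx =>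
    (hu x hx).trans (hA x hx)
  have hv' : ∀ x ∈ X, alloc x ∈ v ↔ .pos (.alloc x) ∈ ψ := fun x hx =>
    (hv x hx).trans (hB x hx)
  refine hs _ (cφ.conj_mem hφ ?_ hu' ?_ hnu hn hnmax hnu')
    _ (cψ.conj_mem hψ ?_ hv' ?_ hmv hm hmmax hmv')
  · simpa only [hs.eq_mem] using heq hw
  · intro x y hx
    rw [hs.pointsTo_mem ((hu' x (core_mem_of_mem hφ hx)).2 hx)]
    exact hpt hw x y hx
  · simpa only [hs.symm.eq_mem] using heq hw'
  · intro x y hx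
    rw [hs.symm.pointsTo_mem ((hv' x (core_mem_of_mem hψ hx)).2 hx)]
    exact hpt hw' x y hx

theorem provable_star_iff_boxStar (hφ : φ ∈ coreTypes X α) (hψ : ψ ∈ coreTypes X α)
    (cφ : Coherent X φ) (cψ : Coherent X ψ) {χ : List Literal}
    (hχ : literals χ = boxStar φ ψ) :
    Provable (iff (star (conj φ) (conj ψ)) (conj χ)) := by
  have mem : ∀ l, l ∈ χ ↔ l ∈ boxStar φ ψ := fun l => by rw [← hχ]; rfl
  refine provable_iff_iff.2 fun w => ?_
  simp only [conj_mem, mem]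
  exact ⟨fun h l hl => boxStar_mem_of_star_mem h hl,
    star_mem_of_boxStar_mem hφ hψ cφ cψ⟩

theorem provable_star_iff_absurd
    (h : ∀ w : World, star (conj φ) (conj ψ) ∉ w) :
    Provable (iff (star (conj φ) (conj ψ)) (conj [.neg (.sizeGe 0)])) :=
  provable_iff_iff.2 fun w => iff_of_false (h w) fun hw => World.neg_mem.1 hw top_mem

theorem mem_conjComb_of_literals_eq (hφ : φ ∈ coreTypes X α) (hψ : ψ ∈ coreTypes X α)
    {χ : List Literal} (hχ : literals χ = boxStar φ ψ) : χ ∈ conjComb X (2 * α) :=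
  fun _ hl => core_mem_of_mem_boxStar hφ hψ (hχ ▸ hl)

end CoreTypes

end SepLog

theorem mainTheorem3 (X : Finset SepLog.PVar) (α : ℕ) (hα : X.card ≤ α)
    (φ ψ : List SepLog.Literal)
    (hφ : φ ∈ SepLog.coreTypes X α) (hψ : ψ ∈ SepLog.coreTypes X α) :
    (∃ χ ∈ SepLog.conjComb X (2 * α),
      SepLog.Provable (.iff (.star (SepLog.conj φ) (SepLog.conj ψ)) (SepLog.conj χ))) ∧
    (SepLog.Satisfiable (SepLog.conj φ) → SepLog.Satisfiable (SepLog.conj ψ) →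
      (∃ χ : List SepLog.Literal, SepLog.literals χ = SepLog.boxStar φ ψ) ∧
      ∀ χ : List SepLog.Literal, SepLog.literals χ = SepLog.boxStar φ ψ →
        χ ∈ SepLog.conjComb X (2 * α) ∧
        SepLog.Provable
          (.iff (.star (SepLog.conj φ) (SepLog.conj ψ)) (SepLog.conj χ))) := by
  have hχ := SepLog.exists_literals_eq_boxStar hφ hψ
  refine ⟨?_, fun sφ sψ => ⟨hχ, fun χ h => ⟨SepLog.mem_conjComb_of_literals_eq hφ hψ h,
    SepLog.provable_star_iff_boxStar hφ hψ (.of_satisfiable hα hφ sφ)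
      (.of_satisfiable hα hψ sψ) h⟩⟩⟩
  -- Without satisfiability, consistency of `φ * ψ` suffices: splitting a world that contains it
  -- puts each factor in a world, hence makes it coherent.
  by_cases h : ∃ w : SepLog.World, .star (SepLog.conj φ) (SepLog.conj ψ) ∈ w
  · obtain ⟨w, hw⟩ := h
    obtain ⟨u, v, -, hu, hv⟩ := SepLog.exists_splits hw
    obtain ⟨χ, hχ⟩ := hχ
    exact ⟨χ, SepLog.mem_conjComb_of_literals_eq hφ hψ hχ,
      SepLog.provable_star_iff_boxStar hφ hψ (.of_world hα hφ hu) (.of_world hα hψ hv) hχ⟩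
  -- The negation of size at least `0` is a contradiction available even when `X` is empty and `α`
  -- is `0`.
  · refine ⟨[.neg (.sizeGe 0)], ?_, SepLog.provable_star_iff_absurd (not_exists.1 h)⟩
    rintro l hl
    obtain rfl := List.mem_singleton.1 hl
    exact Nat.zero_le _
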